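/- Work in the Kauffman--Jones version of $SU(2)$ Chern--Simons theory at level $4$: topological charges $0,1,2,3,4$, Kauffman variable $A=ie^{-i\pi/12}$, unitary (normalized) $6j$-symbols as $F$-moves, and $R$-matrix $R(a,b)_c=(-1)^{(a+b-c)/2}A^{(c(c+2)-a(a+2)-b(b+2))/2}$. States of $n$ anyons of charges $a_1\dots a_n$ and total charge $0$ are written in the orthonormal basis of fusion trees $(c_1,\dots,c_n)$, where $c_k$ is the total charge of the first $k$ anyons; $\sigma_i$ is the positive exchange of the anyons $i$ and $i+1$ and $\sigma_i^{\pm2}$ are the two full twists. The states $|x\rangle$ of the qutrit $2222$ ($x=0,2,4$) and of the qubit $2211$ ($x=0,2$) are the trees with $c_2=x$; put $$e_1=\tfrac{|0\rangle+|4\rangle}{\sqrt2},\qquad e_2=|2\rangle,\qquad e_3=\tfrac{|0\rangle-|4\rangle}{\sqrt2}.$$ (a) A full twist $\sigma_2^{\pm2}$ on the qubit $2211$ swaps the charges $|0\rangle$ and $|2\rangle$ up to a common phase. (b) For $x\in\{0,4\}$, the space of states of four anyons of charges $x222$, or of their mirror image $222x$, is a line $\mathbb C|2\rangle$, spanned by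 a single fusion tree with $c_2=2$, and the middle braid $\sigma_2$ acts on it as multiplication by $e^{4i\pi/3}$. (c) Consider six anyons $222211$, numbered $1,\dots,6$. For $v\in\mathbb C^3$ and $y\in\{0,2\}$ let $\Phi_y(v)$ be the state with $c_3=2$, $c_4=y$, $c_5=1$, in which the charge line $c_2\in\{0,2,4\}$ carries the qutrit state $v_1e_1+v_2e_2+v_3e_3$; so $\Phi_0(v)$ is the qutrit $2222$ in that state together with a pair of $1$'s out of the vacuum. Let $$N=\begin{pmatrix}e^{8i\pi/9}&&\\&e^{8i\pi/9}&\\&&e^{2i\pi/9}\end{pmatrix}.$$ Then $N\in SU(3)$ and, for all choices of the signs, there are phases (independent of $v$) such that for all $v$: 1. a full twist $\sigma_4^{\pm2}$ on anyons $4$ and $5$ maps $\Phi_0(v)$ to a phase times $\Phi_2(v)$, that is, it creates a charge line $2$ between the qutrit and the pair of $1$'s; 2. the braid $\sigma_3\,\sigma_2^{2}\,\sigma_3$ maps $\Phi_2(v)$ to a phase times $\Phi_2(Nv)$; 3. a full twist $\sigma_4^{\pm2}$ on anyons $4$ and $5$ maps $\Phi_2(v)$ to a phase times $\Phi_0(v)$.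 Consequently the whole protocol $\sigma_4^{\pm2}\;\sigma_3\sigma_2^2\sigma_3\;\sigma_4^{\pm2}$, with independent signs (in particular when the last twist undoes the first), maps $\Phi_0(v)$ to a phase times $\Phi_0(Nv)$: up to phase it produces the diagonal qutrit gate $N$ in the basis $(e_1,e_2,e_3)$. -/

import Mathlib

open Complex

noncomputable section

namespace KauffmanJones

/-! The Kauffman–Jones version of `SU(2)` at level `4`: Temperley–Lieb recoupling theory at the
Kauffman variable `A = i e^{-iπ/12}`, with unitary normalization of the trivalent vertices. -/

/-- The topological charges `0, 1, 2, 3, 4`. -/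
abbrev Charge : Type := Fin 5

/-- The Kauffman variable `A = i e^{-iπ/12}`. -/
def kauffmanA : ℂ := I * Complex.exp (-(Real.pi * I / 12))

/-- The quantum integer `[n] = (A^{2n} - A^{-2n}) / (A² - A⁻²)`, a real number
(see `ofReal_quantumInt`). -/
def quantumInt (n : ℕ) : ℝ :=
  (-1) ^ (n + 1) * (Real.sin (n * Real.pi / 6) / Real.sin (Real.pi / 6))

theorem ofReal_quantumInt (n : ℕ) :
    (quantumInt n : ℂ) =
      (kauffmanA ^ (2 * n) - (kauffmanA⁻¹) ^ (2 * n)) / (kauffmanA ^ 2 - (kauffmanA⁻¹) ^ 2) := by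
  have hA : kauffmanA ^ 2 = -Complex.exp (-(Real.pi / 6 * I)) := by
    rw [kauffmanA, mul_pow, I_sq, ← Complex.exp_nat_mul]
    rw [neg_one_mul]
    congr 2
    push_cast
    ring
  have hB : (kauffmanA⁻¹) ^ 2 = -Complex.exp (Real.pi / 6 * I) := by
    rw [inv_pow, hA, ← neg_inv, ← Complex.exp_neg, neg_neg]
  have key : ∀ z : ℂ, 2 * Complex.sin z * I = Complex.exp (z * I) - Complex.exp (-(z * I)) := by
    intro z
    have h := Complex.two_sin z
    have hI : I * I = -1 := I_mul_I
    have e : Complex.exp (-z * I) = Complex.exp (-(z * I)) := by rw [neg_mul]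
    rw [h, e]
    linear_combination (Complex.exp (-(z * I)) - Complex.exp (z * I)) * hI
  have hn : ∀ z : ℂ, Complex.exp z ^ n = Complex.exp (n * z) := fun z =>
    (Complex.exp_nat_mul z n).symm
  rw [pow_mul, pow_mul, hA, hB, neg_pow, neg_pow (Complex.exp _), hn, hn]
  have h1 := key (Real.pi / 6)
  have h2 := key (n * Real.pi / 6)
  have e1 : (n : ℂ) * (Real.pi / 6 * I) = n * Real.pi / 6 * I := by ring
  have e2 : (n : ℂ) * -(Real.pi / 6 * I) = -(n * Real.pi / 6 * I) := by ring
  rw [e1, e2]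
  have h3 : -Complex.exp (-(Real.pi / 6 * I)) - -Complex.exp (Real.pi / 6 * I)
      = 2 * Complex.sin (Real.pi / 6) * I := by rw [h1]; ring
  have h4 : (-1 : ℂ) ^ n * Complex.exp (-(n * Real.pi / 6 * I))
      - (-1) ^ n * Complex.exp (n * Real.pi / 6 * I)
      = (-1) ^ (n + 1) * (2 * Complex.sin (n * Real.pi / 6) * I) := by rw [h2]; ring
  have hs : Complex.sin (Real.pi / 6) ≠ 0 := by
    have : Complex.sin (Real.pi / 6) = ((Real.sin (Real.pi / 6) : ℝ) : ℂ) := by push_cast; rfl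
    rw [this, Real.sin_pi_div_six]
    norm_num
  rw [h3, h4, quantumInt]
  push_cast
  have hI : I ≠ 0 := I_ne_zero
  field_simp

/-- The quantum factorial `[n]! = [1][2]⋯[n]`. -/
def quantumFactorial (n : ℕ) : ℝ := ∏ k ∈ Finset.range n, quantumInt (k + 1)

/-- The value `Δₙ = (-1)ⁿ [n+1]` of an unknot of charge `n` (its quantum dimension). -/
def loopValue (n : ℕ) : ℝ := (-1) ^ n * quantumInt (n + 1)

/-- The fusion rules at level `4`. -/
def Admissible (a b c : ℕ) : Prop :=
  (a + b + c) % 2 = 0 ∧ a ≤ b + c ∧ b ≤ a + c ∧ c ≤ a + b ∧ a + b + c ≤ 8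

instance (a b c : ℕ) : Decidable (Admissible a b c) :=
  inferInstanceAs (Decidable (_ ∧ _))

/-- The theta net `θ(a, b, c)` of an admissible triple. -/
def theta (a b c : ℕ) : ℝ :=
  let m := (a + b - c) / 2
  let n := (a + c - b) / 2
  let p := (b + c - a) / 2
  (-1) ^ (m + n + p) * quantumFactorial (m + n + p + 1) *
      (quantumFactorial m * quantumFactorial n * quantumFactorial p) /
    (quantumFactorial (m + n) * quantumFactorial (n + p) * quantumFactorial (m + p))

/-- Half sums over the four vertices `(a,b,e)`, `(e,c,d)`, `(b,c,f)`, `(a,f,d)` of the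
tetrahedral net. -/
def tetTriples (a b c d e f : ℕ) : Fin 4 → ℕ :=
  ![(a + b + e) / 2, (e + c + d) / 2, (b + c + f) / 2, (a + f + d) / 2]

/-- Half sums over the three quadrilaterals of the tetrahedral net. -/
def tetQuads (a b c d e f : ℕ) : Fin 3 → ℕ :=
  ![(a + b + c + d) / 2, (a + c + e + f) / 2, (b + d + e + f) / 2]

/-- The tetrahedral net with vertices `(a,b,e)`, `(e,c,d)`, `(b,c,f)`, `(a,f,d)`. -/
def tet (a b c d e f : ℕ) : ℝ :=
  let T := tetTriples a b c d e f
  let Q := tetQuads a b c d e f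
  (∏ i, ∏ j, quantumFactorial (Q j - T i)) /
      (quantumFactorial a * quantumFactorial b * quantumFactorial c *
        quantumFactorial d * quantumFactorial e * quantumFactorial f) *
    ∑ s ∈ Finset.Icc (max (max (T 0) (T 1)) (max (T 2) (T 3))) (min (Q 0) (min (Q 1) (Q 2))),
      (-1) ^ s * quantumFactorial (s + 1) /
        ((∏ i, quantumFactorial (s - T i)) * ∏ j, quantumFactorial (Q j - s))

/-- The unitary `6j`-symbol: the entry of the `F`-move from the tree in which `a, b` fuse to `e`
and then `e, c` fuse to `d`, to the tree in which `b, c` fuse to `f` and then `a, f` fuse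
to `d`. It vanishes unless all four vertices are admissible. -/
def sixJ (a b c d e f : ℕ) : ℝ :=
  if Admissible a b e ∧ Admissible e c d ∧ Admissible b c f ∧ Admissible a f d then
    tet a b c d e f *
      Real.sqrt (loopValue e * loopValue f / (theta a b e * theta e c d * theta b c f * theta a f d))
  else 0

/-- The `R`-matrix: the phase of a positive exchange of charges `a`, `b` that fuse to `c`. -/
def rSymbol (a b c : ℕ) : ℂ :=
  (-1) ^ ((a + b - c) / 2) *
    kauffmanA ^ (((c : ℤ) * (c + 2) - (a : ℤ) * (a + 2) - (b : ℤ) * (b + 2)) / 2)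

/-- A charge line `c` fuses with `a` to `e` and then with `b` to `d`. The anyons `a` and `b` are
exchanged (positively or negatively according to `ε`); this is the amplitude of the outcome where
`c` fuses with `b` to `e'` and then with `a` to `d`: an `F`-move, an `R`-move, and an inverse
`F`-move. -/
def braidCoeff (ε : ℤˣ) (c a b d e e' : ℕ) : ℂ :=
  ∑ f : Charge, (sixJ c b a d e' f : ℂ) * rSymbol a b f ^ (ε : ℤ) * (sixJ c a b d e f : ℂ)

/-- Fusion trees of anyons of charges `a 0, a 1, …, a n` and total charge `0`. The charge line
`path k` is the total charge of the first `k` anyons. The trees form an orthonormal basis of the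
space of states of these anyons. -/
abbrev FusionTree {n : ℕ} (a : Fin (n + 1) → Charge) : Type :=
  {path : Fin (n + 2) → Charge //
    path 0 = 0 ∧ path (Fin.last (n + 1)) = 0 ∧
      ∀ k : Fin (n + 1), Admissible (path k.castSucc) (a k) (path k.succ)}

/-- The charges after exchanging the anyons `j` and `j + 1` (counted from `0`). -/
def swapCharges {n : ℕ} (j : Fin n) (a : Fin (n + 1) → Charge) : Fin (n + 1) → Charge :=
  a ∘ Equiv.swap j.castSucc j.succ

/-- The matrix, from trees over `a` to trees over `b`, of the elementary braid exchanging the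
anyons `j` and `j + 1` (counted from `0`); here `b` has to be `swapCharges j a`. Thus
`crossing 1 0` is a `σ₁`-braid, `crossing 1 1` a `σ₂`-braid, and so on, and `crossing (-1)` is the
opposite braid. Only the charge line between the two anyons changes. -/
def crossing {n : ℕ} (ε : ℤˣ) (j : Fin n) (a b : Fin (n + 1) → Charge) :
    Matrix (FusionTree b) (FusionTree a) ℂ :=
  Matrix.of fun t' t =>
    if b = swapCharges j a ∧ ∀ k, k ≠ j.succ.castSucc → t'.1 k = t.1 k then
      braidCoeff ε (t.1 j.castSucc.castSucc) (a j.castSucc) (a j.succ) (t.1 j.succ.succ)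
        (t.1 j.succ.castSucc) (t'.1 j.succ.castSucc)
    else 0

/-- The full twist of the anyons `j` and `j + 1`: two successive crossings. -/
def fullTwist {n : ℕ} (ε : ℤˣ) (j : Fin n) (a : Fin (n + 1) → Charge) :
    Matrix (FusionTree a) (FusionTree a) ℂ :=
  crossing ε j (swapCharges j a) a * crossing ε j a (swapCharges j a)

/-- The basis state of a fusion tree. -/
def ket {n : ℕ} {a : Fin (n + 1) → Charge} (t : FusionTree a) : FusionTree a → ℂ :=
  Pi.single t 1

/-- The state `|0⟩` (`y = 0`) or `|2⟩` (`y = 1`) of the qubit `2211`: the first two anyons have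
total charge `0` or `2`. -/
def qubitTree (y : Fin 2) : FusionTree ![2, 2, 1, 1] :=
  ⟨![0, 2, ![0, 2] y, 1, 0], by revert y; decide⟩

/-- The six anyons `222211`. -/
def sixCharges : Fin 6 → Charge := ![2, 2, 2, 2, 1, 1]

/-- The tree over `222211` in which anyons `1, 2` have total charge `0`, `2`, `4` (`x = 0, 1, 2`),
anyons `1, 2, 3` have total charge `2`, and the charge line between the four `2`'s and the pair of
`1`'s is `0` or `2` (`y = 0, 1`). For `y = 0` this is the qutrit `2222` in the state `|0⟩`, `|2⟩`,
`|4⟩` together with a pair of `1`'s out of the vacuum. -/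
def sixTree (x : Fin 3) (y : Fin 2) : FusionTree sixCharges :=
  ⟨![0, 2, ![0, 2, 4] x, 2, ![0, 2] y, 1, 0], by revert x y; decide⟩

/-- The state of the six anyons with qutrit coordinates `v` with respect to
`e₁ = (|0⟩ + |4⟩)/√2`, `e₂ = |2⟩`, `e₃ = (|0⟩ - |4⟩)/√2`, and with charge line `0` or `2`
(`y = 0, 1`) between the four `2`'s and the pair of `1`'s. -/
def encode (y : Fin 2) (v : Fin 3 → ℂ) : FusionTree sixCharges → ℂ :=
  v 0 • (((1 / Real.sqrt 2 : ℝ) : ℂ) • (ket (sixTree 0 y) + ket (sixTree 2 y))) +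
    v 1 • ket (sixTree 1 y) +
    v 2 • (((1 / Real.sqrt 2 : ℝ) : ℂ) • (ket (sixTree 0 y) - ket (sixTree 2 y)))

/-- The braids on the extended qutrit: a `σ₃`-braid, a full twist `σ₂²`, a `σ₃`-braid. -/
def extendedBraid : Matrix (FusionTree sixCharges) (FusionTree sixCharges) ℂ :=
  crossing 1 2 sixCharges sixCharges * fullTwist 1 1 sixCharges *
    crossing 1 2 sixCharges sixCharges

/-- The whole protocol: a full twist of anyons `4` and `5`, the braids on the extended qutrit, and
a full twist of anyons `4` and `5`. The signs `ε`, `ε'` are the directions of the two twists; for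
`ε' = -ε` the second one undoes the first. -/
def protocol (ε ε' : ℤˣ) : Matrix (FusionTree sixCharges) (FusionTree sixCharges) ℂ :=
  fullTwist ε' 3 sixCharges * extendedBraid * fullTwist ε 3 sixCharges

/-- The gate `N = diag(e^{8iπ/9}, e^{8iπ/9}, e^{2iπ/9})`. -/
def gateN : Matrix (Fin 3) (Fin 3) ℂ :=
  Matrix.diagonal ![Complex.exp (8 * Real.pi * I / 9), Complex.exp (8 * Real.pi * I / 9),
    Complex.exp (2 * Real.pi * I / 9)]

end KauffmanJones

end

noncomputable section

namespace KauffmanJones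

/-! ### Quantum integers, theta nets and tetrahedral nets -/

theorem quantumInt_values :
    quantumInt 1 = 1 ∧ quantumInt 2 = -√3 ∧ quantumInt 3 = 2 ∧ quantumInt 4 = -√3 ∧
      quantumInt 5 = 1 := by
  have h2 : (2 : ℝ) * Real.pi / 6 = Real.pi / 3 := by ring
  have h3 : (3 : ℝ) * Real.pi / 6 = Real.pi / 2 := by ring
  have h4 : (4 : ℝ) * Real.pi / 6 = Real.pi - Real.pi / 3 := by ring
  have h5 : (5 : ℝ) * Real.pi / 6 = Real.pi - Real.pi / 6 := by ring
  norm_num [quantumInt, h2, h3, h4, h5, Real.sin_pi_sub]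
  ring

theorem sqrt_three_powers :
    √3 ^ 2 = (3 : ℝ) ∧ √3 ^ 3 = (3 : ℝ) * √3 ∧ √3 ^ 4 = (9 : ℝ) ∧ √3 ^ 6 = (27 : ℝ) := by
  have h : √3 ^ 2 = (3 : ℝ) := by norm_num
  refine ⟨h, ?_, ?_, ?_⟩
  · rw [show 3 = 2 + 1 from rfl, pow_succ, h]
  · rw [show 4 = 2 * 2 from rfl, pow_mul, h]; norm_num
  · rw [show 6 = 2 * 3 from rfl, pow_mul, h]; norm_num

theorem quantumFactorial_values :
    quantumFactorial 0 = 1 ∧ quantumFactorial 1 = 1 ∧ quantumFactorial 2 = -√3 ∧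
      quantumFactorial 3 = -(√3 * 2) ∧ quantumFactorial 4 = 6 ∧ quantumFactorial 5 = 6 := by
  simp only [quantumFactorial, Finset.prod_range_succ, Finset.prod_range_zero, Nat.reduceAdd,
    quantumInt_values]
  have h := sqrt_three_powers.1
  refine ⟨trivial, ?_, ?_, ?_, ?_, ?_⟩ <;> grind

theorem loopValue_values :
    loopValue 0 = 1 ∧ loopValue 1 = √3 ∧ loopValue 2 = 2 ∧ loopValue 3 = √3 ∧
      loopValue 4 = 1 := by
  norm_num [loopValue, quantumInt_values]

theorem theta_values :
    theta 0 1 1 = √3 ∧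
    theta 0 2 2 = 2 ∧
    theta 1 2 1 = 2 ∧
    theta 1 2 3 = √3 ∧
    theta 2 0 2 = 2 ∧
    theta 2 1 1 = 2 ∧
    theta 2 1 3 = √3 ∧
    theta 2 2 0 = 2 ∧
    theta 2 2 2 = 2/3 * √3 ∧
    theta 2 2 4 = 1 ∧
    theta 2 3 1 = √3 ∧
    theta 2 4 2 = 1 ∧
    theta 3 2 1 = √3 ∧
    theta 4 2 2 = 1 := by
  refine ⟨?_, ?_, ?_, ?_, ?_, ?_, ?_, ?_, ?_, ?_, ?_, ?_, ?_, ?_⟩ <;>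
    simp [theta, quantumFactorial_values] <;> field_simp <;> norm_num [sqrt_three_powers]

theorem tet_values :
    tet 0 2 2 2 2 2 = 2/3 * √3 ∧
    tet 2 1 2 1 1 1 = -2/3 * √3 ∧
    tet 2 1 2 1 1 3 = √3 ∧
    tet 2 1 2 1 3 1 = √3 ∧
    tet 2 1 2 1 3 3 = 1/2 * √3 ∧
    tet 2 2 1 1 0 1 = 2 ∧
    tet 2 2 1 1 0 3 = √3 ∧
    tet 2 2 1 1 2 1 = 2/3 * √3 ∧
    tet 2 2 1 1 2 3 = -1 ∧
    tet 2 2 2 0 2 2 = 2/3 * √3 ∧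
    tet 2 2 2 2 0 0 = 2 ∧
    tet 2 2 2 2 0 2 = 2/3 * √3 ∧
    tet 2 2 2 2 0 4 = 1 ∧
    tet 2 2 2 2 2 0 = 2/3 * √3 ∧
    tet 2 2 2 2 2 4 = -1/3 * √3 ∧
    tet 2 2 2 2 4 0 = 1 ∧
    tet 2 2 2 2 4 2 = -1/3 * √3 ∧
    tet 2 2 2 2 4 4 = 1/2 ∧
    tet 2 2 2 4 2 2 = -1/3 * √3 ∧
    tet 4 2 2 2 2 2 = -1/3 * √3 := by
  refine ⟨?_, ?_, ?_, ?_, ?_, ?_, ?_, ?_, ?_, ?_, ?_, ?_, ?_, ?_, ?_, ?_, ?_, ?_, ?_, ?_⟩ <;>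
    simp [tet, tetTriples, tetQuads, Fin.prod_univ_four, Fin.prod_univ_three,
      quantumFactorial_values] <;>
    field_simp <;> norm_num [sqrt_three_powers]

/-! ### Unitary 6j-symbols -/

/-- A nonzero real is determined by its sign and its square. This replaces the square root in the
unitary normalization by polynomial identities in √2 and √3. -/
theorem sixJ_eq_of_sq {a b c d e f : ℕ} {x : ℝ}
    (h : Admissible a b e ∧ Admissible e c d ∧ Admissible b c f ∧ Admissible a f d)
    (hx : 0 < x * tet a b c d e f)
    (hθ : 0 < theta a b e * theta e c d * theta b c f * theta a f d)
    (hsq : x ^ 2 * (theta a b e * theta e c d * theta b c f * theta a f d) =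
      tet a b c d e f ^ 2 * (loopValue e * loopValue f)) :
    sixJ a b c d e f = x := by
  have ht : tet a b c d e f ≠ 0 := right_ne_zero_of_mul hx.ne'
  have hq : loopValue e * loopValue f /
      (theta a b e * theta e c d * theta b c f * theta a f d) = (x / tet a b c d e f) ^ 2 := by
    rw [div_pow, div_eq_div_iff hθ.ne' (pow_ne_zero 2 ht), mul_comm, hsq.symm]
  have hr : 0 ≤ x / tet a b c d e f := by
    rw [← mul_div_mul_right _ _ ht]
    exact div_nonneg hx.le (mul_self_nonneg _)
  rw [sixJ, if_pos h, hq, Real.sqrt_sq hr, mul_div_cancel₀ _ ht]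

theorem sixJ_eq_zero {a b c d e f : ℕ}
    (h : ¬(Admissible a b e ∧ Admissible e c d ∧ Admissible b c f ∧ Admissible a f d)) :
    sixJ a b c d e f = 0 := if_neg h

/-- The net has two terms, s = 3 and s = 4, proportional to -[4]! and [5]!, which cancel because [5]
= 1. The sign criterion of `sixJ_eq_of_sq` excludes the value zero, hence the separate proof. -/
theorem sixJ_222222 : sixJ 2 2 2 2 2 2 = 0 := by
  have h : tet 2 2 2 2 2 2 = 0 := by
    simp [tet, tetTriples, tetQuads, Fin.prod_univ_four, Fin.prod_univ_three,
      Finset.sum_Icc_succ_top, quantumFactorial_values]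
    field_simp
    norm_num [sqrt_three_powers]
  rw [sixJ, h, zero_mul, ite_self]

theorem sixJ_values :
    sixJ 0 2 2 2 2 2 = 1 ∧
    sixJ 2 1 2 1 1 1 = -1 / 2 ∧
    sixJ 2 1 2 1 1 3 = √3 / 2 ∧
    sixJ 2 1 2 1 3 1 = √3 / 2 ∧
    sixJ 2 1 2 1 3 3 = 1 / 2 ∧
    sixJ 2 2 1 1 0 1 = √2 / 2 ∧
    sixJ 2 2 1 1 0 3 = √2 / 2 ∧
    sixJ 2 2 1 1 2 1 = √2 / 2 ∧
    sixJ 2 2 1 1 2 3 = -√2 / 2 ∧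
    sixJ 2 2 2 0 2 2 = 1 ∧
    sixJ 2 2 2 2 0 0 = 1 / 2 ∧
    sixJ 2 2 2 2 0 2 = √2 / 2 ∧
    sixJ 2 2 2 2 0 4 = 1 / 2 ∧
    sixJ 2 2 2 2 2 0 = √2 / 2 ∧
    sixJ 2 2 2 2 2 4 = -√2 / 2 ∧
    sixJ 2 2 2 2 4 0 = 1 / 2 ∧
    sixJ 2 2 2 2 4 2 = -√2 / 2 ∧
    sixJ 2 2 2 2 4 4 = 1 / 2 ∧
    sixJ 2 2 2 4 2 2 = -1 ∧
    sixJ 4 2 2 2 2 2 = -1 := by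
  refine ⟨?_, ?_, ?_, ?_, ?_, ?_, ?_, ?_, ?_, ?_, ?_, ?_, ?_, ?_, ?_, ?_, ?_, ?_, ?_, ?_⟩ <;>
    refine sixJ_eq_of_sq (by decide) ?_ ?_ ?_ <;>
    norm_num [tet_values, theta_values, loopValue_values, mul_pow, div_pow, sqrt_three_powers] <;>
    ring_nf <;> norm_num [sqrt_three_powers] <;> ring

theorem braidCoeff_eq_zero {ε : ℤˣ} {c a b d e e' : ℕ}
    (h : ¬(Admissible c b e' ∧ Admissible e' a d)) : braidCoeff ε c a b d e e' = 0 := by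
  refine Finset.sum_eq_zero fun f _ => ?_
  have h0 : sixJ c b a d e' f = 0 := if_neg fun h' => h ⟨h'.1, h'.2.1⟩
  simp [h0]

/-! ### Crossings and full twists acting on basis states -/

/-- The state of a path, which is zero if the path is not a fusion tree. -/
def pathKet {n : ℕ} (a : Fin (n + 1) → Charge) (p : Fin (n + 2) → Charge) : FusionTree a → ℂ :=
  fun t => if t.1 = p then 1 else 0

theorem pathKet_eq_ket {n : ℕ} {a : Fin (n + 1) → Charge} {p : Fin (n + 2) → Charge}
    (t : FusionTree a) (h : p = t.1) : pathKet a p = ket t := by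
  subst h
  ext s
  simp [pathKet, ket, Pi.single_apply, Subtype.ext_iff]

/-- The charges of the tree `t` with the charge line between the anyons `j` and `j + 1` replaced
by `x`. -/
def replaceLine {n : ℕ} {a : Fin (n + 1) → Charge} (j : Fin n) (t : FusionTree a) (x : Charge) :
    Fin (n + 2) → Charge :=
  Function.update t.1 j.succ.castSucc x

/-- Reads off a column of the crossing matrix. With `pathKet` the sum can run over all five charges,
without a proof that each new path is a tree. -/
theorem crossing_mulVec_ket {n : ℕ} (ε : ℤˣ) (j : Fin n) {a b : Fin (n + 1) → Charge}
    (hb : b = swapCharges j a) (t : FusionTree a) :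
    (crossing ε j a b).mulVec (ket t) =
      ∑ x : Charge, braidCoeff ε (t.1 j.castSucc.castSucc) (a j.castSucc) (a j.succ)
        (t.1 j.succ.succ) (t.1 j.succ.castSucc) x • pathKet b (replaceLine j t x) := by
  ext t'
  rw [ket, Matrix.mulVec_single_one]
  simp only [Matrix.col_apply, crossing, Matrix.of_apply, hb, true_and, Finset.sum_apply,
    Pi.smul_apply, smul_eq_mul, pathKet, mul_ite, mul_one, mul_zero]
  have key (x : Charge) : t'.1 = replaceLine j t x ↔
      (∀ k, k ≠ j.succ.castSucc → t'.1 k = t.1 k) ∧ t'.1 j.succ.castSucc = x := by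
    rw [replaceLine, Function.eq_update_iff, and_comm]
  simp only [key, ite_and]
  split_ifs <;> simp

/-- The amplitude of a full twist of the anyons `a` and `b`, in the notation of `braidCoeff`. -/
def twistCoeff (ε : ℤˣ) (c a b d e e' : ℕ) : ℂ :=
  ∑ x : Charge, braidCoeff ε c b a d x e' * braidCoeff ε c a b d e x

/-- Only the two vertices at the replaced line change, so their fusion rules, with the anyons in
exchanged order, suffice. -/
theorem exists_tree_replaceLine {n : ℕ} {j : Fin n} {a : Fin (n + 1) → Charge}
    {t : FusionTree a} {x : Charge} (h₁ : Admissible (t.1 j.castSucc.castSucc) (a j.succ) x)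
    (h₂ : Admissible x (a j.castSucc) (t.1 j.succ.succ)) :
    ∃ s : FusionTree (swapCharges j a), s.1 = replaceLine j t x := by
  obtain ⟨p, h0, hl, h⟩ := t
  refine ⟨⟨replaceLine j ⟨p, h0, hl, h⟩ x, ?_, ?_, fun k => ?_⟩, rfl⟩
  · rw [replaceLine, Function.update_of_ne]
    · exact h0
    · simp [Fin.ext_iff]
  · rw [replaceLine, Function.update_of_ne]
    · exact hl
    · simp only [ne_eq, Fin.ext_iff, Fin.val_last, Fin.val_castSucc, Fin.val_succ]
      omega
  · simp only [replaceLine, Function.update_apply, swapCharges, Function.comp_apply]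
    by_cases hk : k = j.castSucc
    · subst hk
      simpa [Fin.ext_iff, Equiv.swap_apply_left] using h₁
    by_cases hk' : k = j.succ
    · subst hk'
      simpa [Fin.ext_iff, Equiv.swap_apply_right] using h₂
    rw [if_neg (by simpa [Fin.ext_iff] using hk'), if_neg (by simpa [Fin.ext_iff] using hk),
      Equiv.swap_apply_of_ne_of_ne hk hk']
    exact h k

theorem fullTwist_mulVec_ket {n : ℕ} (ε : ℤˣ) (j : Fin n) (a : Fin (n + 1) → Charge)
    (t : FusionTree a) :
    (fullTwist ε j a).mulVec (ket t) =
      ∑ y : Charge, twistCoeff ε (t.1 j.castSucc.castSucc) (a j.castSucc) (a j.succ)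
        (t.1 j.succ.succ) (t.1 j.succ.castSucc) y • pathKet a (replaceLine j t y) := by
  have hs : a = swapCharges j (swapCharges j a) := by
    ext k
    simp [swapCharges]
  have hne₁ : j.castSucc.castSucc ≠ j.succ.castSucc := by simp [Fin.ext_iff]
  have hne₂ : j.succ.succ ≠ j.succ.castSucc := by simp [Fin.ext_iff]
  rw [fullTwist, ← Matrix.mulVec_mulVec, crossing_mulVec_ket ε j rfl, Matrix.mulVec_sum]
  simp only [twistCoeff, Finset.sum_smul, mul_smul]
  rw [Finset.sum_comm]
  refine Finset.sum_congr rfl fun x _ => ?_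
  rw [Matrix.mulVec_smul]
  -- If the intermediate line is admissible, the second crossing acts on a genuine tree; otherwise
  -- the amplitude of the first crossing already vanishes.
  by_cases h : Admissible (t.1 j.castSucc.castSucc) (a j.succ) x ∧
      Admissible x (a j.castSucc) (t.1 j.succ.succ)
  · obtain ⟨s, hs'⟩ := exists_tree_replaceLine h.1 h.2
    rw [pathKet_eq_ket s hs'.symm, crossing_mulVec_ket ε j hs, Finset.smul_sum]
    refine Finset.sum_congr rfl fun y _ => ?_
    have e (z : Charge) : replaceLine j s z = replaceLine j t z := by
      rw [replaceLine, hs', replaceLine, replaceLine, Function.update_idem]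
    rw [smul_comm, e, hs', replaceLine, Function.update_of_ne hne₁, Function.update_of_ne hne₂,
      Function.update_self]
    simp [swapCharges]
  · simp [braidCoeff_eq_zero h]

/-! ### Exchange phases and braid amplitudes -/

/-- The primitive third root of unity `e^{2iπ/3}`. -/
def omega : ℂ := Complex.exp (2 * Real.pi * I / 3)

theorem omega_pow_three : omega ^ 3 = 1 := by
  rw [omega, ← Complex.exp_nat_mul, ← Complex.exp_two_pi_mul_I]
  congr 1
  push_cast
  ring

theorem norm_omega : ‖omega‖ = 1 :=
  norm_eq_one_of_pow_eq_one omega_pow_three three_ne_zero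

theorem kauffmanA_pow_four : kauffmanA ^ 4 = -omega := by
  have h : -omega = Complex.exp (-(Real.pi * I)) * omega := by
    rw [Complex.exp_neg, Complex.exp_pi_mul_I]
    norm_num
  rw [h, kauffmanA, mul_pow, I_pow_four, one_mul, ← Complex.exp_nat_mul, omega, ← Complex.exp_add]
  congr 1
  push_cast
  ring

theorem rSymbol_values :
    rSymbol 2 2 0 = omega ∧ rSymbol 2 2 2 = omega ^ 2 ∧ rSymbol 2 2 4 = -omega ∧
      rSymbol 1 2 1 = omega ^ 2 ∧ rSymbol 2 1 1 = omega ^ 2 ∧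
      rSymbol 1 2 3 = kauffmanA ^ 2 ∧ rSymbol 2 1 3 = kauffmanA ^ 2 := by
  have h0 : omega⁻¹ = omega ^ 2 :=
    inv_eq_of_mul_eq_one_left (by linear_combination omega_pow_three)
  have h4 : (kauffmanA ^ 4)⁻¹ = -omega ^ 2 := by
    rw [kauffmanA_pow_four, inv_neg, h0]
  have h8 : (kauffmanA ^ 8)⁻¹ = omega := by
    rw [show 8 = 4 * 2 from rfl, pow_mul, ← inv_pow, h4]
    linear_combination omega * omega_pow_three
  have z8 : kauffmanA ^ (-8 : ℤ) = (kauffmanA ^ 8)⁻¹ := by norm_cast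
  have z4 : kauffmanA ^ (-4 : ℤ) = (kauffmanA ^ 4)⁻¹ := by norm_cast
  have z4' : kauffmanA ^ (4 : ℤ) = kauffmanA ^ 4 := by norm_cast
  have z2 : kauffmanA ^ (2 : ℤ) = kauffmanA ^ 2 := by norm_cast
  norm_num [rSymbol, h0, h8, h4, z8, z4, z4', z2, kauffmanA_pow_four]

theorem ofReal_sqrt_sq :
    ((√2 : ℝ) : ℂ) ^ 2 = 2 ∧ ((√3 : ℝ) : ℂ) ^ 2 = 3 := by
  constructor <;> norm_cast <;> simp

theorem braidCoeff_2222_values :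
    braidCoeff 1 2 2 2 2 0 0 = omega ^ 2 / 2 ∧
    braidCoeff 1 2 2 2 2 0 2 = omega * (√2 : ℝ) / 2 ∧
    braidCoeff 1 2 2 2 2 0 4 = -omega ^ 2 / 2 ∧
    braidCoeff 1 2 2 2 2 2 0 = omega * (√2 : ℝ) / 2 ∧
    braidCoeff 1 2 2 2 2 2 2 = 0 ∧
    braidCoeff 1 2 2 2 2 2 4 = omega * (√2 : ℝ) / 2 ∧
    braidCoeff 1 2 2 2 2 4 0 = -omega ^ 2 / 2 ∧
    braidCoeff 1 2 2 2 2 4 2 = omega * (√2 : ℝ) / 2 ∧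
    braidCoeff 1 2 2 2 2 4 4 = omega ^ 2 / 2 ∧
    braidCoeff 1 0 2 2 2 2 2 = omega ^ 2 ∧
    braidCoeff 1 4 2 2 2 2 2 = omega ^ 2 ∧
    braidCoeff 1 2 2 2 0 2 2 = omega ^ 2 ∧
    braidCoeff 1 2 2 2 4 2 2 = omega ^ 2 := by
  have h2 := ofReal_sqrt_sq.1
  refine ⟨?_, ?_, ?_, ?_, ?_, ?_, ?_, ?_, ?_, ?_, ?_, ?_, ?_⟩ <;>
    simp [braidCoeff, Fin.sum_univ_five, sixJ_values, sixJ_222222, sixJ_eq_zero, Admissible,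
      rSymbol_values] <;> grind

/-- P and Q are the exchange phases of 2 and 1 with total charge 1 and 3; keeping them abstract
treats both braid directions at once. -/
theorem braidCoeff_2211_values (ε : ℤˣ) {P Q : ℂ} (hP : (omega ^ 2) ^ (ε : ℤ) = P)
    (hQ : (kauffmanA ^ 2) ^ (ε : ℤ) = Q) :
    braidCoeff ε 2 2 1 1 0 1 = (√2 : ℝ) / 4 * ((√3 : ℝ) * Q - P) ∧
    braidCoeff ε 2 2 1 1 0 3 = (√2 : ℝ) / 4 * ((√3 : ℝ) * P + Q) ∧
    braidCoeff ε 2 2 1 1 2 1 = (√2 : ℝ) / 4 * (-(√3 : ℝ) * Q - P) ∧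
    braidCoeff ε 2 2 1 1 2 3 = (√2 : ℝ) / 4 * ((√3 : ℝ) * P - Q) ∧
    braidCoeff ε 2 1 2 1 1 0 = (√2 : ℝ) / 4 * ((√3 : ℝ) * Q - P) ∧
    braidCoeff ε 2 1 2 1 3 0 = (√2 : ℝ) / 4 * ((√3 : ℝ) * P + Q) ∧
    braidCoeff ε 2 1 2 1 1 2 = (√2 : ℝ) / 4 * (-(√3 : ℝ) * Q - P) ∧
    braidCoeff ε 2 1 2 1 3 2 = (√2 : ℝ) / 4 * ((√3 : ℝ) * P - Q) := by
  refine ⟨?_, ?_, ?_, ?_, ?_, ?_, ?_, ?_⟩ <;>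
    simp [braidCoeff, Fin.sum_univ_five, sixJ_values, sixJ_eq_zero, Admissible,
      rSymbol_values, hP, hQ] <;> ring

/-- The diagonal amplitudes are (P² + Q²)/2 and the others (P² - Q²)/2. They become 0 and P² = ω^ε,
since Q² = A^{4ε} = -ω^ε. -/
theorem twistCoeff_2211_values (ε : ℤˣ) :
    twistCoeff ε 2 2 1 1 0 0 = 0 ∧
    twistCoeff ε 2 2 1 1 0 2 = omega ^ (ε : ℤ) ∧
    twistCoeff ε 2 2 1 1 2 0 = omega ^ (ε : ℤ) ∧
    twistCoeff ε 2 2 1 1 2 2 = 0 := by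
  have h2 := ofReal_sqrt_sq.1
  have h3 := ofReal_sqrt_sq.2
  have hP : ((omega ^ 2) ^ (ε : ℤ)) ^ 2 = omega ^ (ε : ℤ) := by
    rw [← zpow_natCast, zpow_comm, zpow_natCast, ← pow_mul]
    congr 1
    linear_combination omega * omega_pow_three
  have hQ : ((kauffmanA ^ 2) ^ (ε : ℤ)) ^ 2 = -omega ^ (ε : ℤ) := by
    rw [← zpow_natCast, zpow_comm, zpow_natCast, ← pow_mul, kauffmanA_pow_four]
    obtain rfl | rfl := Int.units_eq_one_or ε <;> simp [inv_neg]
  refine ⟨?_, ?_, ?_, ?_⟩ <;>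
    simp [twistCoeff, Fin.sum_univ_five, braidCoeff_2211_values ε rfl rfl, braidCoeff_eq_zero,
      Admissible] <;> grind

theorem twistCoeff_2222_values :
    twistCoeff 1 2 2 2 2 0 0 = (omega ^ 2 + omega) / 2 ∧
    twistCoeff 1 2 2 2 2 0 2 = 0 ∧
    twistCoeff 1 2 2 2 2 0 4 = (omega ^ 2 - omega) / 2 ∧
    twistCoeff 1 2 2 2 2 4 0 = (omega ^ 2 - omega) / 2 ∧
    twistCoeff 1 2 2 2 2 4 2 = 0 ∧
    twistCoeff 1 2 2 2 2 4 4 = (omega ^ 2 + omega) / 2 ∧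
    twistCoeff 1 2 2 2 0 2 2 = omega ∧
    twistCoeff 1 2 2 2 4 2 2 = omega := by
  have h2 := ofReal_sqrt_sq.1
  have h := omega_pow_three
  refine ⟨?_, ?_, ?_, ?_, ?_, ?_, ?_, ?_⟩ <;>
    simp [twistCoeff, Fin.sum_univ_five, braidCoeff_2222_values, braidCoeff_eq_zero,
      Admissible] <;> grind

theorem twistCoeff_eq_zero {ε : ℤˣ} {c a b d e e' : ℕ}
    (h : ¬(Admissible c a e' ∧ Admissible e' b d)) : twistCoeff ε c a b d e e' = 0 :=
  Finset.sum_eq_zero fun _ _ => by rw [braidCoeff_eq_zero h, zero_mul]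

/-! ### Braids on the qubit `2211` and on the six anyons -/

theorem sixCharges_values :
    sixCharges 0 = 2 ∧ sixCharges 1 = 2 ∧ sixCharges 2 = 2 ∧ sixCharges 3 = 2 ∧
      sixCharges 4 = 1 ∧ sixCharges 5 = 1 := by
  decide

theorem qubitTree_val (y : Fin 2) : (qubitTree y).1 = ![0, 2, ![0, 2] y, 1, 0] := rfl

theorem sixTree_val (x : Fin 3) (y : Fin 2) :
    (sixTree x y).1 = ![0, 2, ![0, 2, 4] x, 2, ![0, 2] y, 1, 0] := rfl

theorem fullTwist_mulVec_qubitTree (ε : ℤˣ) (y : Fin 2) :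
    (fullTwist ε 1 ![2, 2, 1, 1]).mulVec (ket (qubitTree y)) =
      omega ^ (ε : ℤ) • ket (qubitTree (y + 1)) := by
  have e (y : Fin 2) :
      pathKet ![2, 2, 1, 1] (replaceLine 1 (qubitTree y) 0) = ket (qubitTree 0) ∧
      pathKet ![2, 2, 1, 1] (replaceLine 1 (qubitTree y) 2) = ket (qubitTree 1) := by
    refine ⟨pathKet_eq_ket _ ?_, pathKet_eq_ket _ ?_⟩ <;> revert y <;> decide
  rw [fullTwist_mulVec_ket]
  fin_cases y <;>
    simp [Fin.sum_univ_five, qubitTree_val, twistCoeff_eq_zero, Admissible,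
      twistCoeff_2211_values, e]

set_option maxRecDepth 4000 in
theorem fullTwist_mulVec_sixTree (ε : ℤˣ) (x : Fin 3) (y : Fin 2) :
    (fullTwist ε 3 sixCharges).mulVec (ket (sixTree x y)) =
      omega ^ (ε : ℤ) • ket (sixTree x (y + 1)) := by
  have e (y : Fin 2) :
      pathKet sixCharges (replaceLine 3 (sixTree x y) 0) = ket (sixTree x 0) ∧
      pathKet sixCharges (replaceLine 3 (sixTree x y) 2) = ket (sixTree x 1) := by
    refine ⟨pathKet_eq_ket _ ?_, pathKet_eq_ket _ ?_⟩ <;> revert x y <;> decide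
  rw [fullTwist_mulVec_ket]
  fin_cases y <;>
    simp [Fin.sum_univ_five, sixTree_val, sixCharges_values, twistCoeff_eq_zero, Admissible,
      twistCoeff_2211_values, e]

/-- The trees over `222211` in which anyons `1, 2` have total charge `2` and anyons `1, 2, 3` have
total charge `0` or `4` (`z = 0, 1`). -/
def tiltedTree (z : Fin 2) : FusionTree sixCharges :=
  ⟨![0, 2, 2, ![0, 4] z, 2, 1, 0], by revert z; decide⟩

theorem tiltedTree_val (z : Fin 2) : (tiltedTree z).1 = ![0, 2, 2, ![0, 4] z, 2, 1, 0] := rfl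

/-- Next to c₂ = 0 the only admissible c₃ is 2, so the braid is a scalar; the same holds for c₂ = 4.
-/
theorem crossing_two_mulVec_sixTree_zero :
    (crossing 1 2 sixCharges sixCharges).mulVec (ket (sixTree 0 1)) =
      omega ^ 2 • ket (sixTree 0 1) := by
  rw [crossing_mulVec_ket 1 2 (by decide),
    ← pathKet_eq_ket (p := replaceLine 2 (sixTree 0 1) 2) (sixTree 0 1) (by decide)]
  simp [Fin.sum_univ_five, sixTree_val, sixCharges_values, braidCoeff_eq_zero, Admissible,
    braidCoeff_2222_values]

theorem crossing_two_mulVec_sixTree_two :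
    (crossing 1 2 sixCharges sixCharges).mulVec (ket (sixTree 2 1)) =
      omega ^ 2 • ket (sixTree 2 1) := by
  rw [crossing_mulVec_ket 1 2 (by decide),
    ← pathKet_eq_ket (p := replaceLine 2 (sixTree 2 1) 2) (sixTree 2 1) (by decide)]
  simp [Fin.sum_univ_five, sixTree_val, sixCharges_values, braidCoeff_eq_zero, Admissible,
    braidCoeff_2222_values]

/-- The amplitude from c₃ = 2 to itself is zero, so the state leaves c₃ = 2 completely. -/
theorem crossing_two_mulVec_sixTree_one :
    (crossing 1 2 sixCharges sixCharges).mulVec (ket (sixTree 1 1)) =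
      (omega * (√2 : ℝ) / 2) • (ket (tiltedTree 0) + ket (tiltedTree 1)) := by
  rw [crossing_mulVec_ket 1 2 (by decide),
    ← pathKet_eq_ket (p := replaceLine 2 (sixTree 1 1) 0) (tiltedTree 0) (by decide),
    ← pathKet_eq_ket (p := replaceLine 2 (sixTree 1 1) 4) (tiltedTree 1) (by decide)]
  simp [Fin.sum_univ_five, sixTree_val, sixCharges_values, braidCoeff_eq_zero, Admissible,
    braidCoeff_2222_values]

/-- In the sum, the amplitudes ω²/2 and -ω²/2 into each of c₃ = 0 and c₃ = 4 cancel, and only c₃ = 2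
survives. -/
theorem crossing_two_mulVec_tiltedTree :
    (crossing 1 2 sixCharges sixCharges).mulVec (ket (tiltedTree 0) + ket (tiltedTree 1)) =
      (omega * (√2 : ℝ)) • ket (sixTree 1 1) := by
  have e (z : Fin 2) : pathKet sixCharges (replaceLine 2 (tiltedTree z) 0) = ket (tiltedTree 0) ∧
      pathKet sixCharges (replaceLine 2 (tiltedTree z) 2) = ket (sixTree 1 1) ∧
      pathKet sixCharges (replaceLine 2 (tiltedTree z) 4) = ket (tiltedTree 1) := by
    refine ⟨pathKet_eq_ket _ ?_, pathKet_eq_ket _ ?_, pathKet_eq_ket _ ?_⟩ <;> revert z <;> decide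
  rw [Matrix.mulVec_add, crossing_mulVec_ket 1 2 (by decide), crossing_mulVec_ket 1 2 (by decide)]
  simp [Fin.sum_univ_five, e, tiltedTree_val, sixCharges_values, braidCoeff_eq_zero, Admissible,
    braidCoeff_2222_values]
  module

theorem fullTwist_one_mulVec_sixTree_zero :
    (fullTwist 1 1 sixCharges).mulVec (ket (sixTree 0 1)) =
      ((omega ^ 2 + omega) / 2) • ket (sixTree 0 1) +
        ((omega ^ 2 - omega) / 2) • ket (sixTree 2 1) := by
  rw [fullTwist_mulVec_ket,
    ← pathKet_eq_ket (p := replaceLine 1 (sixTree 0 1) 0) (sixTree 0 1) (by decide),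
    ← pathKet_eq_ket (p := replaceLine 1 (sixTree 0 1) 4) (sixTree 2 1) (by decide)]
  simp [Fin.sum_univ_five, sixTree_val, sixCharges_values, twistCoeff_eq_zero, Admissible,
    twistCoeff_2222_values]

theorem fullTwist_one_mulVec_sixTree_two :
    (fullTwist 1 1 sixCharges).mulVec (ket (sixTree 2 1)) =
      ((omega ^ 2 - omega) / 2) • ket (sixTree 0 1) +
        ((omega ^ 2 + omega) / 2) • ket (sixTree 2 1) := by
  rw [fullTwist_mulVec_ket,
    ← pathKet_eq_ket (p := replaceLine 1 (sixTree 2 1) 0) (sixTree 0 1) (by decide),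
    ← pathKet_eq_ket (p := replaceLine 1 (sixTree 2 1) 4) (sixTree 2 1) (by decide)]
  simp [Fin.sum_univ_five, sixTree_val, sixCharges_values, twistCoeff_eq_zero, Admissible,
    twistCoeff_2222_values]

theorem fullTwist_one_mulVec_tiltedTree (z : Fin 2) :
    (fullTwist 1 1 sixCharges).mulVec (ket (tiltedTree z)) = omega • ket (tiltedTree z) := by
  rw [fullTwist_mulVec_ket,
    ← pathKet_eq_ket (p := replaceLine 1 (tiltedTree z) 2) (tiltedTree z) (by revert z; decide)]
  fin_cases z <;>
    simp [Fin.sum_univ_five, tiltedTree_val, sixCharges_values, twistCoeff_eq_zero, Admissible,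
      twistCoeff_2222_values]

theorem extendedBraid_mulVec (v : Fin 3 → ℂ) :
    extendedBraid.mulVec (encode 1 v) = encode 1 ![v 0, v 1, omega ^ 2 * v 2] := by
  have h2 := ofReal_sqrt_sq.1
  have h := omega_pow_three
  have h1 : extendedBraid.mulVec (ket (sixTree 1 1)) = ket (sixTree 1 1) := by
    rw [extendedBraid, ← Matrix.mulVec_mulVec, ← Matrix.mulVec_mulVec,
      crossing_two_mulVec_sixTree_one, Matrix.mulVec_smul, Matrix.mulVec_add,
      fullTwist_one_mulVec_tiltedTree, fullTwist_one_mulVec_tiltedTree, ← smul_add,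
      Matrix.mulVec_smul, Matrix.mulVec_smul,
      crossing_two_mulVec_tiltedTree, smul_smul, smul_smul]
    convert one_smul ℂ _
    -- The successive factors are ω√2/2, ω and ω√2, with product ω³ = 1.
    linear_combination omega ^ 3 / 2 * h2 + h
  have h0 : extendedBraid.mulVec (ket (sixTree 0 1)) =
      ((1 + omega ^ 2) / 2) • ket (sixTree 0 1) + ((1 - omega ^ 2) / 2) • ket (sixTree 2 1) := by
    rw [extendedBraid, ← Matrix.mulVec_mulVec, ← Matrix.mulVec_mulVec]
    simp only [crossing_two_mulVec_sixTree_zero, Matrix.mulVec_smul, Matrix.mulVec_add,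
      fullTwist_one_mulVec_sixTree_zero, crossing_two_mulVec_sixTree_two, smul_add, smul_smul]
    congr 2
    · linear_combination (omega ^ 3 + 1 + omega ^ 2) / 2 * h
    · linear_combination (omega ^ 3 + 1 - omega ^ 2) / 2 * h
  have h4 : extendedBraid.mulVec (ket (sixTree 2 1)) =
      ((1 - omega ^ 2) / 2) • ket (sixTree 0 1) + ((1 + omega ^ 2) / 2) • ket (sixTree 2 1) := by
    rw [extendedBraid, ← Matrix.mulVec_mulVec, ← Matrix.mulVec_mulVec]
    simp only [crossing_two_mulVec_sixTree_zero, Matrix.mulVec_smul, Matrix.mulVec_add,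
      fullTwist_one_mulVec_sixTree_two, crossing_two_mulVec_sixTree_two, smul_add, smul_smul]
    congr 2
    · linear_combination (omega ^ 3 + 1 - omega ^ 2) / 2 * h
    · linear_combination (omega ^ 3 + 1 + omega ^ 2) / 2 * h
  simp only [encode, Matrix.mulVec_add, Matrix.mulVec_sub, Matrix.mulVec_smul, h0, h1, h4,
    Matrix.cons_val]
  module

/-! ### The gate `N` and the whole protocol -/

theorem gateN_mulVec (v : Fin 3 → ℂ) :
    gateN.mulVec v = Complex.exp (8 * Real.pi * I / 9) • ![v 0, v 1, omega ^ 2 * v 2] := by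
  have h : Complex.exp (2 * Real.pi * I / 9) =
      Complex.exp (8 * Real.pi * I / 9) * omega ^ 2 := by
    rw [omega, ← Complex.exp_nat_mul, ← Complex.exp_add, Complex.exp_eq_exp_iff_exists_int]
    -- In units of iπ: 2/9 = 8/9 + 4/3 - 2, one full turn less.
    exact ⟨-1, by push_cast; ring⟩
  ext i
  fin_cases i <;> simp only [gateN, Matrix.mulVec_diagonal, h]
  · rfl
  · rfl
  · exact mul_assoc _ _ _

theorem encode_smul (y : Fin 2) (c : ℂ) (v : Fin 3 → ℂ) :
    encode y (c • v) = c • encode y v := by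
  simp only [encode, Pi.smul_apply, smul_eq_mul, smul_add, mul_smul]

theorem fullTwist_mulVec_encode (ε : ℤˣ) (y : Fin 2) (v : Fin 3 → ℂ) :
    (fullTwist ε 3 sixCharges).mulVec (encode y v) = omega ^ (ε : ℤ) • encode (y + 1) v := by
  simp only [encode, Matrix.mulVec_add, Matrix.mulVec_sub, Matrix.mulVec_smul,
    fullTwist_mulVec_sixTree]
  module

theorem extendedBraid_mulVec_encode (v : Fin 3 → ℂ) :
    extendedBraid.mulVec (encode 1 v) =
      (Complex.exp (8 * Real.pi * I / 9))⁻¹ • encode 1 (gateN.mulVec v) := by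
  rw [gateN_mulVec, encode_smul, smul_smul, inv_mul_cancel₀ (Complex.exp_ne_zero _), one_smul,
    extendedBraid_mulVec]

theorem norm_omega_zpow (n : ℤ) : ‖omega ^ n‖ = 1 := by
  rw [norm_zpow, norm_omega, one_zpow]

theorem gateN_mem_specialUnitaryGroup : gateN ∈ Matrix.specialUnitaryGroup (Fin 3) ℂ := by
  have hc (x : ℝ) : (starRingEnd ℂ) (Complex.exp (x * I)) * Complex.exp (x * I) = 1 := by
    rw [mul_comm, Complex.mul_conj, Complex.normSq_eq_norm_sq, Complex.norm_exp_ofReal_mul_I]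
    norm_num
  have h8 := hc (8 * Real.pi / 9)
  have h2 := hc (2 * Real.pi / 9)
  push_cast at h8 h2
  rw [div_mul_eq_mul_div] at h8 h2
  rw [Matrix.mem_specialUnitaryGroup_iff, Matrix.mem_unitaryGroup_iff']
  constructor
  · rw [gateN, Matrix.star_eq_conjTranspose, Matrix.diagonal_conjTranspose,
      Matrix.diagonal_mul_diagonal, ← Matrix.diagonal_one]
    congr 1
    ext i
    fin_cases i
    · exact h8
    · exact h8
    · exact h2
  · rw [gateN, Matrix.det_diagonal, Fin.prod_univ_three]
    simp only [Matrix.cons_val]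
    -- The three angles sum to 2π: 8/9 + 8/9 + 2/9 = 2.
    rw [← Complex.exp_add, ← Complex.exp_add, ← Complex.exp_two_pi_mul_I]
    congr 1
    ring

theorem norm_exp_eight_pi_div_nine : ‖Complex.exp (8 * Real.pi * I / 9)‖ = 1 := by
  have h : 8 * Real.pi * I / 9 = ((8 * Real.pi / 9 : ℝ) : ℂ) * I := by push_cast; ring
  rw [h, Complex.norm_exp_ofReal_mul_I]

theorem omega_sq : omega ^ 2 = Complex.exp (4 * Real.pi * I / 3) := by
  rw [omega, ← Complex.exp_nat_mul]
  congr 1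
  push_cast
  ring

theorem protocol_mulVec_encode (ε ε' : ℤˣ) (v : Fin 3 → ℂ) :
    (protocol ε ε').mulVec (encode 0 v) =
      (omega ^ (ε : ℤ) * ((Complex.exp (8 * Real.pi * I / 9))⁻¹ * omega ^ (ε' : ℤ))) •
        encode 0 (gateN.mulVec v) := by
  rw [protocol, ← Matrix.mulVec_mulVec, ← Matrix.mulVec_mulVec, fullTwist_mulVec_encode,
    Matrix.mulVec_smul, zero_add, extendedBraid_mulVec_encode, Matrix.mulVec_smul,
    Matrix.mulVec_smul, fullTwist_mulVec_encode, smul_smul, smul_smul,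
    mul_assoc]
  rfl

/-! ### Middle braids on `x222` and `222x` -/

/-- A space of four anyons is a line if the fusion rules determine its tree. -/
theorem fusionTree_eq_of_admissible {a : Fin 4 → Charge} (t : FusionTree a)
    (h : ∀ p q r : Charge, Admissible 0 (a 0) p → Admissible p (a 1) q → Admissible q (a 2) r →
      Admissible r (a 3) 0 → p = t.1 1 ∧ q = t.1 2 ∧ r = t.1 3) (s : FusionTree a) : s = t := by
  obtain ⟨p, h0, hl, hp⟩ := s
  have h1 := hp 0
  have h4 := hp 3
  have hl' : p 4 = 0 := hl
  simp only [Fin.isValue, Fin.castSucc_zero, h0] at h1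
  change Admissible (p 3) (a 3) (p 4) at h4
  rw [hl'] at h4
  obtain ⟨e1, e2, e3⟩ := h (p 1) (p 2) (p 3) h1 (hp 1) (hp 2) h4
  apply Subtype.ext
  ext k
  fin_cases k
  · exact congrArg Fin.val (h0.trans t.2.1.symm)
  · exact congrArg Fin.val e1
  · exact congrArg Fin.val e2
  · exact congrArg Fin.val e3
  · exact congrArg Fin.val (hl.trans t.2.2.1.symm)

/-- Since `h0` forbids every line other than 2 after the crossing, a single amplitude ω² = e^{4iπ/3}
remains. -/
theorem crossing_middle_mulVec_ket {a : Fin 4 → Charge} (t : FusionTree a)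
    (ha : a = swapCharges 1 a) (h2 : t.1 2 = 2)
    (hb : braidCoeff 1 (t.1 1) (a 1) (a 2) (t.1 3) 2 2 = omega ^ 2)
    (h0 : ∀ x : Charge, x ≠ 2 →
      ¬(Admissible (t.1 1) (a 2) x ∧ Admissible x (a 1) (t.1 3))) :
    (crossing 1 1 a a).mulVec (ket t) = Complex.exp (4 * Real.pi * I / 3) • ket t := by
  rw [crossing_mulVec_ket 1 1 ha, ← omega_sq]
  have e : replaceLine 1 t 2 = t.1 := by
    rw [replaceLine, Function.update_eq_self_iff]
    exact h2.symm
  rw [Finset.sum_eq_single 2]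
  · rw [pathKet_eq_ket t e]
    congr 1
    change braidCoeff 1 (t.1 1) (a 1) (a 2) (t.1 3) (t.1 2) 2 = _
    rw [h2]
    exact hb
  · intro x _ hx
    rw [braidCoeff_eq_zero, zero_smul]
    exact h0 x hx
  · simp

theorem existsUnique_tree_middle_braid {x : Charge} (hx : x = 0 ∨ x = 4)
    {a : Fin 4 → Charge} (ha : a = ![x, 2, 2, 2] ∨ a = ![2, 2, 2, x]) :
    ∃ t : FusionTree a, (∀ s : FusionTree a, s = t) ∧ t.1 2 = 2 ∧
      (crossing 1 1 a a).mulVec (ket t) = Complex.exp (4 * Real.pi * I / 3) • ket t := by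
  have h := braidCoeff_2222_values
  obtain rfl | rfl := hx <;> obtain rfl | rfl := ha
  · let t : FusionTree ![0, 2, 2, 2] := ⟨![0, 0, 2, 2, 0], by decide⟩
    exact ⟨t, fusionTree_eq_of_admissible t (by decide), rfl,
      crossing_middle_mulVec_ket t (by decide) rfl h.2.2.2.2.2.2.2.2.2.1
        (by decide)⟩
  · let t : FusionTree ![2, 2, 2, 0] := ⟨![0, 2, 2, 0, 0], by decide⟩
    exact ⟨t, fusionTree_eq_of_admissible t (by decide), rfl,
      crossing_middle_mulVec_ket t (by decide) rfl h.2.2.2.2.2.2.2.2.2.2.2.1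
        (by decide)⟩
  · let t : FusionTree ![4, 2, 2, 2] := ⟨![0, 4, 2, 2, 0], by decide⟩
    exact ⟨t, fusionTree_eq_of_admissible t (by decide), rfl,
      crossing_middle_mulVec_ket t (by decide) rfl h.2.2.2.2.2.2.2.2.2.2.1
        (by decide)⟩
  · let t : FusionTree ![2, 2, 2, 4] := ⟨![0, 2, 2, 4, 0], by decide⟩
    exact ⟨t, fusionTree_eq_of_admissible t (by decide), rfl,
      crossing_middle_mulVec_ket t (by decide) rfl h.2.2.2.2.2.2.2.2.2.2.2.2
        (by decide)⟩

end KauffmanJones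

end

theorem mainTheorem5 :
    -- A full twist of the two middle anyons of `2211` swaps `|0⟩` and `|2⟩`, up to a phase.
    (∀ ε : ℤˣ, ∃ c : ℂ, ‖c‖ = 1 ∧
      (KauffmanJones.fullTwist ε 1 ![2, 2, 1, 1]).mulVec
          (KauffmanJones.ket (KauffmanJones.qubitTree 0)) =
        c • KauffmanJones.ket (KauffmanJones.qubitTree 1) ∧
      (KauffmanJones.fullTwist ε 1 ![2, 2, 1, 1]).mulVec
          (KauffmanJones.ket (KauffmanJones.qubitTree 1)) =
        c • KauffmanJones.ket (KauffmanJones.qubitTree 0)) ∧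
    -- A middle braid on `0222`, `4222` or on their mirror images preserves `ℂ|2⟩`, which is the
    -- whole space of states, and is multiplication by `e^{4iπ/3}`.
    (∀ x : KauffmanJones.Charge, x = 0 ∨ x = 4 →
      ∀ a : Fin 4 → KauffmanJones.Charge, a = ![x, 2, 2, 2] ∨ a = ![2, 2, 2, x] →
        ∃ t : KauffmanJones.FusionTree a, (∀ s : KauffmanJones.FusionTree a, s = t) ∧
          t.1 2 = 2 ∧
          (KauffmanJones.crossing 1 1 a a).mulVec (KauffmanJones.ket t) =
            Complex.exp (4 * Real.pi * Complex.I / 3) • KauffmanJones.ket t) ∧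
    -- The first full twist of anyons 4 and 5 creates a charge line 2.
    (∀ ε : ℤˣ, ∃ c : ℂ, ‖c‖ = 1 ∧ ∀ v : Fin 3 → ℂ,
      (KauffmanJones.fullTwist ε 3 KauffmanJones.sixCharges).mulVec (KauffmanJones.encode 0 v) =
        c • KauffmanJones.encode 1 v) ∧
    -- The braids on the extended qutrit return a qutrit `2222` and a qubit `2211`, and act by `N`.
    (∃ c : ℂ, ‖c‖ = 1 ∧ ∀ v : Fin 3 → ℂ,
      KauffmanJones.extendedBraid.mulVec (KauffmanJones.encode 1 v) =
        c • KauffmanJones.encode 1 (KauffmanJones.gateN.mulVec v)) ∧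
    -- The last full twist of anyons 4 and 5 restores the pair of `1`'s out of the vacuum.
    (∀ ε : ℤˣ, ∃ c : ℂ, ‖c‖ = 1 ∧ ∀ v : Fin 3 → ℂ,
      (KauffmanJones.fullTwist ε 3 KauffmanJones.sixCharges).mulVec (KauffmanJones.encode 1 v) =
        c • KauffmanJones.encode 0 v) ∧
    -- The gate `N` has determinant 1, and the whole protocol is `N` up to a phase.
    KauffmanJones.gateN ∈ Matrix.specialUnitaryGroup (Fin 3) ℂ ∧
    (∀ ε ε' : ℤˣ, ∃ c : ℂ, ‖c‖ = 1 ∧ ∀ v : Fin 3 → ℂ,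
      (KauffmanJones.protocol ε ε').mulVec (KauffmanJones.encode 0 v) =
        c • KauffmanJones.encode 0 (KauffmanJones.gateN.mulVec v)) := by
  have hexp : ‖(Complex.exp (8 * Real.pi * Complex.I / 9))⁻¹‖ = 1 := by
    rw [norm_inv, KauffmanJones.norm_exp_eight_pi_div_nine, inv_one]
  open KauffmanJones in
  exact ⟨fun ε => ⟨omega ^ (ε : ℤ), norm_omega_zpow _, fullTwist_mulVec_qubitTree ε 0,
      fullTwist_mulVec_qubitTree ε 1⟩,
    fun x hx a ha => existsUnique_tree_middle_braid hx ha,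
    fun ε => ⟨omega ^ (ε : ℤ), norm_omega_zpow _, fullTwist_mulVec_encode ε 0⟩,
    ⟨_, hexp, extendedBraid_mulVec_encode⟩,
    fun ε => ⟨omega ^ (ε : ℤ), norm_omega_zpow _, fullTwist_mulVec_encode ε 1⟩,
    gateN_mem_specialUnitaryGroup,
    fun ε ε' => ⟨_, by rw [norm_mul, norm_mul, norm_omega_zpow, norm_omega_zpow, hexp]; norm_num,
      protocol_mulVec_encode ε ε'⟩⟩
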